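/- Let $Q_n$ denote the $n$-dimensional hypercube graph, whose vertices are the binary strings of length $n$, two being adjacent if and only if they differ in exactly one coordinate. A labeling of the vertices of a finite graph $G$ with two labels is called $2$-distinguishing if the only automorphism of $G$ that preserves the labels is the identity, and the cost of $2$-distinguishing $\rho(G)$ of a graph $G$ that admits such a labeling is the minimum size of a label class, taken over all $2$-distinguishing labelings of $G$. Theorem. If $n \ge 5$, then $$\rho(Q_n) \in \{\,1+\lceil \log_2 n\rceil,\ 2+\lceil \log_2 n\rceil\,\}.$$ -/

import Mathlib

/-- The hypercube graph `Q_n`: the vertices are the binary strings of length `n`, two of them being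
adjacent exactly when they differ in precisely one coordinate. -/
def hypercube (n : ℕ) : SimpleGraph (Fin n → ZMod 2) where
  Adj x y := hammingDist x y = 1
  symm := ⟨fun x y h => by rw [hammingDist_comm]; exact h⟩
  loopless := ⟨fun x h => by simp at h⟩

/-- A labeling of the vertices of `G` with `d` labels is distinguishing if no nontrivial
automorphism of `G` preserves the labels. -/
def IsDistinguishingLabeling {V : Type*} (G : SimpleGraph V) (d : ℕ) (c : V → Fin d) : Prop :=
  ∀ φ : G ≃g G, (∀ v, c (φ v) = c v) → φ = RelIso.refl G.Adj

/-- `S` is a label class of some 2-distinguishing labeling of `G`. -/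
def IsDistinguishingClass {V : Type*} (G : SimpleGraph V) (S : Set V) : Prop :=
  ∃ (c : V → Fin 2) (i : Fin 2), IsDistinguishingLabeling G 2 c ∧ S = {v | c v = i}

/-- The cost of 2-distinguishing `ρ(G)` of a finite graph `G`: the minimum size of a label class,
over all 2-distinguishing labelings of `G`. It has the value `0` if `G` is not
2-distinguishable. -/
noncomputable def distinguishingCost {V : Type*} [Finite V] (G : SimpleGraph V) : ℕ :=
  sInf {k : ℕ | ∃ S : Set V, IsDistinguishingClass G S ∧ S.ncard = k}

section HypercubeAutomorphisms

variable {n : ℕ}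

/-! Read a label class `S` of size `m` as an `m` × `n` binary matrix whose rows are its members. By
`exists_perm_translation`, automorphisms permute the columns and complement some of them; those
preserving `S` also permute the rows. Lower bound: if two columns agree up to complement,
`swapAddAut` fixes every row, so `n ≤ 2 ^ (m - 1)`. Upper bound: with `L = ⌈log₂ n⌉`, take `L + 2`
rows and let the columns be `n` bipartitions of the rows that no nontrivial row permutation
preserves (`exists_asymmetric_family`). Among the singletons and pairs, these record a path on the
rows with one end marked. -/

lemma ZMod.two_eq_zero_or_one (a : ZMod 2) : a = 0 ∨ a = 1 := by
  revert a; decide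

lemma exists_hammingDist_eq_one_and {x y : Fin n → ZMod 2} {k : ℕ}
    (h : hammingDist x y = k + 1) :
    ∃ z, hammingDist x z = 1 ∧ hammingDist z y = k := by
  obtain ⟨i, hi⟩ : ∃ i, x i ≠ y i := by
    by_contra! hc
    rw [funext hc, hammingDist_self] at h
    omega
  refine ⟨Function.update x i (y i), ?_, ?_⟩
  · rw [hammingDist, Finset.card_eq_one]
    refine ⟨i, ?_⟩
    ext j
    by_cases hj : j = i
    · subst hj; simp [hi]
    · simp [hj]
  · have : (Finset.univ.filter fun j => Function.update x i (y i) j ≠ y j)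
        = (Finset.univ.filter fun j => x j ≠ y j).erase i := by
      ext j
      by_cases hj : j = i
      · subst hj; simp
      · simp [hj]
    rw [hammingDist, this, Finset.card_erase_of_mem (by simpa using hi)]
    rw [hammingDist] at h
    omega

lemma hammingDist_map_le (φ : hypercube n ≃g hypercube n) (k : ℕ) :
    ∀ x y, hammingDist x y = k → hammingDist (φ x) (φ y) ≤ k := by
  induction k with
  | zero =>
    intro x y h
    rw [hammingDist_eq_zero] at h
    simp [h]
  | succ k ih =>
    intro x y h
    obtain ⟨z, hz, hzy⟩ := exists_hammingDist_eq_one_and h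
    have h1 : hammingDist (φ x) (φ z) = 1 := φ.map_rel_iff.2 hz
    have h2 := ih z y hzy
    have h3 := hammingDist_triangle (φ x) (φ z) (φ y)
    omega

lemma hammingDist_map (φ : hypercube n ≃g hypercube n) (x y : Fin n → ZMod 2) :
    hammingDist (φ x) (φ y) = hammingDist x y := by
  refine le_antisymm (hammingDist_map_le φ _ x y rfl) ?_
  simpa using hammingDist_map_le φ.symm _ (φ x) (φ y) rfl

lemma hammingNorm_single_one (i : Fin n) :
    hammingNorm (Pi.single i 1 : Fin n → ZMod 2) = 1 := by
  rw [hammingNorm, Finset.card_eq_one]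
  refine ⟨i, ?_⟩
  ext j
  by_cases hj : j = i
  · subst hj; simp
  · simp [hj]

lemma exists_eq_single_of_hammingNorm_eq_one {x : Fin n → ZMod 2} (h : hammingNorm x = 1) :
    ∃ i, x = Pi.single i 1 := by
  rw [hammingNorm, Finset.card_eq_one] at h
  obtain ⟨i, hi⟩ := h
  refine ⟨i, ?_⟩
  ext1 j
  have hj := Finset.ext_iff.1 hi j
  simp only [Finset.mem_filter, Finset.mem_univ, true_and, Finset.mem_singleton] at hj
  by_cases hji : j = i
  · subst hji
    simpa using (ZMod.two_eq_zero_or_one (x j)).resolve_left (hj.2 rfl)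
  · simpa [hji] using hj

/-- Coordinates are recovered from distances alone, so an isometry fixing `0` is determined by its
action on unit vectors. -/
lemma hammingDist_single_one_lt_iff (x : Fin n → ZMod 2) (i : Fin n) :
    hammingDist x (Pi.single i 1) < hammingNorm x ↔ x i = 1 := by
  constructor
  · intro h
    by_contra hx
    refine absurd h (not_lt.2 (Finset.card_le_card fun j hj => ?_))
    simp only [Finset.mem_filter, Finset.mem_univ, true_and] at hj ⊢
    by_cases hji : j = i
    · subst hji; simpa using hx
    · simpa [hji] using hj
  · intro hx
    refine Finset.card_lt_card (Finset.ssubset_iff_subset_ne.2 ⟨fun j hj => ?_, fun h => ?_⟩)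
    · simp only [Finset.mem_filter, Finset.mem_univ, true_and] at hj ⊢
      by_cases hji : j = i
      · subst hji; simp [hx]
      · simpa [hji] using hj
    · have := (Finset.ext_iff.1 h i).2 (by simp [hx])
      simp [hx] at this

/-- Every automorphism of the hypercube permutes the coordinates and translates. -/
lemma exists_perm_translation (φ : hypercube n ≃g hypercube n) :
    ∃ (π : Equiv.Perm (Fin n)) (t : Fin n → ZMod 2), ∀ x i, φ x (π i) = x i + t (π i) := by
  set ψ : (Fin n → ZMod 2) → (Fin n → ZMod 2) := fun x => φ x - φ 0 with hψ
  have hdist : ∀ x y, hammingDist (ψ x) (ψ y) = hammingDist x y := by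
    intro x y
    rw [← hammingDist_map φ x y, hammingDist_eq_hammingNorm, hammingDist_eq_hammingNorm]
    congr 1
    simp only [hψ]
    abel
  have h0 : ψ 0 = 0 := by simp [hψ]
  have hnorm : ∀ x, hammingNorm (ψ x) = hammingNorm x := by
    intro x
    have := hdist x 0
    rwa [h0, hammingDist_zero_right, hammingDist_zero_right] at this
  choose π hπ using fun i : Fin n =>
    exists_eq_single_of_hammingNorm_eq_one ((hnorm _).trans (hammingNorm_single_one i))
  have hinj : Function.Injective π := by
    intro i j hij
    have h1 : ψ (Pi.single i 1) = ψ (Pi.single j 1) := by rw [hπ, hπ, hij]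
    have h2 := hdist (Pi.single i 1) (Pi.single j 1)
    rw [h1, hammingDist_self, eq_comm, hammingDist_eq_zero] at h2
    by_contra hne
    have := congrFun h2 i
    simp [hne] at this
  refine ⟨Equiv.ofBijective π (Finite.injective_iff_bijective.1 hinj), φ 0, fun x i => ?_⟩
  have key : ψ x (π i) = 1 ↔ x i = 1 := by
    rw [← hammingDist_single_one_lt_iff, ← hammingDist_single_one_lt_iff, ← hπ, hdist, hnorm]
  have : ψ x (π i) = x i := by
    rcases ZMod.two_eq_zero_or_one (ψ x (π i)) with h | h <;>
    rcases ZMod.two_eq_zero_or_one (x i) with h' | h' <;> simp_all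
  rw [Equiv.ofBijective_apply, ← this]
  simp [hψ]

/-- The automorphism of the hypercube swapping the coordinates `i` and `j`
and adding `c` to both of them. -/
def swapAddAut (i j : Fin n) (c : ZMod 2) : hypercube n ≃g hypercube n :=
  let f : (Fin n → ZMod 2) → (Fin n → ZMod 2) := fun x k =>
    x (Equiv.swap i j k) + if k = i ∨ k = j then c else 0
  have hf : Function.Involutive f := by
    intro x
    funext k
    have hk : (Equiv.swap i j k = i ∨ Equiv.swap i j k = j) ↔ (k = i ∨ k = j) := by
      rw [Equiv.swap_apply_eq_iff, Equiv.swap_apply_eq_iff]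
      simp [or_comm]
    simp only [f, hk, Equiv.swap_apply_self, add_assoc, CharTwo.add_self_eq_zero, add_zero]
  { toEquiv := hf.toPerm
    map_rel_iff' := by
      intro x y
      change hammingDist (f x) (f y) = 1 ↔ hammingDist x y = 1
      have : hammingDist (f x) (f y) = hammingDist x y := by
        refine Finset.card_equiv (Equiv.swap i j) fun k => ?_
        simp [f]
      rw [this] }

lemma swapAddAut_apply (i j : Fin n) (c : ZMod 2) (x : Fin n → ZMod 2) (k : Fin n) :
    swapAddAut i j c x k = x (Equiv.swap i j k) + if k = i ∨ k = j then c else 0 := rfl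

end HypercubeAutomorphisms

/-! ### Lower bound: columns are distinct up to complement. -/

lemma isDistinguishingClass_iff {V : Type*} (G : SimpleGraph V) (S : Set V) :
    IsDistinguishingClass G S ↔
      ∀ φ : G ≃g G, (∀ v, φ v ∈ S ↔ v ∈ S) → φ = RelIso.refl G.Adj := by
  constructor
  · rintro ⟨c, i, hc, rfl⟩ φ hφ
    refine hc φ fun v => ?_
    have := hφ v
    simp only [Set.mem_ofPred_eq] at this
    omega
  · intro h
    classical
    refine ⟨fun v => if v ∈ S then 1 else 0, 1, fun φ hφ => h φ fun v => ?_, ?_⟩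
    · have := hφ v
      by_cases h1 : φ v ∈ S <;> by_cases h2 : v ∈ S <;> simp_all
    · ext v
      simp

lemma exists_ne_add_of_isDistinguishingClass {n : ℕ} {S : Set (Fin n → ZMod 2)}
    (hS : IsDistinguishingClass (hypercube n) S) {i j : Fin n} (hij : i ≠ j) (c : ZMod 2) :
    ∃ x ∈ S, x i ≠ x j + c := by
  by_contra! h
  have hfix : ∀ x ∈ S, swapAddAut i j c x = x := by
    intro x hx
    funext k
    rw [swapAddAut_apply]
    by_cases hki : k = i
    · subst hki
      simp [h x hx]
    · by_cases hkj : k = j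
      · subst hkj
        simp [h x hx, add_assoc, CharTwo.add_self_eq_zero]
      · simp [Equiv.swap_apply_of_ne_of_ne hki hkj, hki, hkj]
  have hone := (isDistinguishingClass_iff _ S).1 hS (swapAddAut i j c) fun v => by
    refine ⟨fun hv => ?_, fun hv => by rwa [hfix v hv]⟩
    have := (swapAddAut i j c).injective (hfix _ hv)
    rwa [this] at hv
  -- The `i`-th entry `c + 1` of this vector becomes `0 + c`, so the automorphism is not the
  -- identity.
  have := congrFun (congrArg (fun φ : hypercube n ≃g hypercube n => φ (Pi.single i (c + 1))) hone) i
  simp only [swapAddAut_apply, RelIso.refl_apply] at this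
  simp [hij.symm] at this

lemma le_two_pow_of_isDistinguishingClass {n : ℕ} {S : Set (Fin n → ZMod 2)}
    (hS : IsDistinguishingClass (hypercube n) S) : n ≤ 2 ^ (S.ncard - 1) := by
  classical
  rcases S.eq_empty_or_nonempty with rfl | ⟨s₀, hs₀⟩
  · by_contra! hn
    simp only [Set.ncard_empty, Nat.zero_sub, pow_zero] at hn
    obtain ⟨x, hx, -⟩ := exists_ne_add_of_isDistinguishingClass hS
      (i := ⟨0, by omega⟩) (j := ⟨1, hn⟩) (by simp) 0
    exact hx
  -- Subtracting row `s₀` normalises each column up to complement, leaving one bit for each other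
  -- row.
  · let f : Fin n → ((S \ {s₀} : Set (Fin n → ZMod 2)) → ZMod 2) := fun i s => s.1 i - s₀ i
    have hf : Function.Injective f := by
      intro i j h
      by_contra hij
      obtain ⟨x, hx, hne⟩ := exists_ne_add_of_isDistinguishingClass hS hij (s₀ i - s₀ j)
      apply hne
      by_cases hxs : x = s₀
      · subst hxs; ring
      · have : x i - s₀ i = x j - s₀ j := congrFun h ⟨x, hx, hxs⟩
        linear_combination this
    have := Nat.card_le_card_of_injective f hf
    rwa [Nat.card_fun, Nat.card_fin, Nat.card_zmod, Nat.card_coe_set_eq,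
      Set.ncard_sdiff_singleton_of_mem hs₀] at this

/-! ### An asymmetric family of bipartitions. -/

lemma choose_two_lt_two_pow {L : ℕ} (hL : 3 ≤ L) : (L + 1).choose 2 + 1 ≤ 2 ^ L := by
  induction L, hL using Nat.le_induction with
  | base => decide
  | succ L hL ih =>
    have h1 : (L + 1 + 1).choose 2 = (L + 1).choose 1 + (L + 1).choose 2 := Nat.choose_succ_succ _ _
    have h2 : L < 2 ^ L := Nat.lt_two_pow_self
    rw [Nat.choose_one_right] at h1
    rw [pow_succ]
    omega

/-- A permutation of `Fin (k + 2)` that preserves the edges of the path and does not interchange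
its end points is the identity. -/
lemma perm_eq_one_of_path {k : ℕ} (σ : Equiv.Perm (Fin (k + 2)))
    (h : ∀ i j, ((σ i).val + 1 = σ j ∨ (σ j).val + 1 = σ i) ↔ (i.val + 1 = j ∨ j.val + 1 = i))
    (h0 : σ 0 ≠ Fin.last (k + 1)) : σ = 1 := by
  -- An interior image would have two neighbours, but `0` has only one.
  have hzero : σ 0 = 0 := by
    by_contra hne
    have h1 : (σ 0).val ≠ 0 := fun hc => hne (Fin.ext hc)
    have h2 : (σ 0).val ≠ k + 1 := fun hc => h0 (Fin.ext hc)
    have h3 := (σ 0).isLt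
    obtain ⟨a, ha⟩ := σ.surjective ⟨(σ 0).val - 1, by omega⟩
    obtain ⟨b, hb⟩ := σ.surjective ⟨(σ 0).val + 1, by omega⟩
    have ha' := congrArg Fin.val ha
    have hb' := congrArg Fin.val hb
    simp only at ha' hb'
    have h4 := (h 0 a).1 (by omega)
    have h5 := (h 0 b).1 (by omega)
    simp only [Fin.val_zero] at h4 h5
    have : a = b := Fin.ext (by omega)
    rw [this] at ha'
    omega
  have hall : ∀ v (hv : v < k + 2), σ ⟨v, hv⟩ = ⟨v, hv⟩ := by
    intro v
    induction v using Nat.strong_induction_on with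
    | _ v ih =>
      intro hv
      rcases v with _ | v
      · exact hzero
      · have h1 := ih v (by omega) (by omega)
        have h2 := (h ⟨v, by omega⟩ ⟨v + 1, hv⟩).2 (by simp)
        rw [h1] at h2
        simp only at h2
        rcases h2 with h2 | h2
        · exact Fin.ext h2.symm
        · exfalso
          have h3 := ih (v - 1) (by omega) (by omega)
          have h4 : σ ⟨v + 1, hv⟩ = σ ⟨v - 1, by omega⟩ := by
            rw [h3]; exact Fin.ext (by simp only; omega)
          have := congrArg Fin.val (σ.injective h4)
          simp only at this
          omega
  exact Equiv.ext fun i => hall i.1 i.2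

/-- For `L + 2 ≤ n ≤ 2 ^ L` there are `n` bipartitions of a set with `L + 2` elements, given by
their parts that avoid a fixed element, which no nontrivial permutation preserves. -/
lemma exists_asymmetric_family {L n : ℕ} (hL : 3 ≤ L) (h1 : L + 2 ≤ n) (h2 : n ≤ 2 ^ L) :
    ∃ A : Finset (Finset (Fin (L + 2))), A.card = n ∧ (∀ s ∈ A, 0 ∉ s) ∧
      ∀ σ : Equiv.Perm (Fin (L + 2)),
        (∀ s, (s.image σ ∈ A ∨ (s.image σ)ᶜ ∈ A) ↔ (s ∈ A ∨ sᶜ ∈ A)) → σ = 1 := by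
  let T : Finset (Finset (Fin (L + 2))) := (Finset.univ.erase 0).powerset
  have hT : T.card = 2 ^ (L + 1) := by simp [T]
  have hmemT : ∀ s, s ∈ T ↔ 0 ∉ s := by
    intro s
    simp [T, Finset.subset_erase]
  -- `norm` picks the part avoiding `0` of the bipartition `{s, sᶜ}`.
  let norm : Finset (Fin (L + 2)) → Finset (Fin (L + 2)) := fun s => if 0 ∈ s then sᶜ else s
  have hnormT : ∀ s, norm s ∈ T := by
    intro s
    rw [hmemT]
    by_cases hs : 0 ∈ s <;> simp [norm, hs]
  have hnorm_eq : ∀ s t, norm s = norm t → s = t ∨ s = tᶜ := by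
    intro s t h
    simp only [norm] at h
    split_ifs at h
    · exact Or.inl (compl_injective h)
    · exact Or.inr (by rw [← h, compl_compl])
    · exact Or.inr h
    · exact Or.inl h
  -- The complement of a set of size at most 2 has at least `L ≥ 3` elements.
  have hnorm_inj : ∀ s t, s.card ≤ 2 → t.card ≤ 2 → norm s = norm t → s = t := by
    intro s t hs ht h
    rcases hnorm_eq s t h with h | h
    · exact h
    · have := congrArg Finset.card h
      rw [Finset.card_compl, Fintype.card_fin] at this
      omega
  let E : Finset (Finset (Fin (L + 2))) :=
    Finset.univ.image fun i : Fin (L + 1) => {i.castSucc, i.succ}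
  have hE : ∀ i j : Fin (L + 2), {i, j} ∈ E ↔ (i.val + 1 = j ∨ j.val + 1 = i) := by
    intro i j
    simp only [E, Finset.mem_image, Finset.mem_univ, true_and]
    constructor
    · rintro ⟨a, ha⟩
      have hi : i ∈ ({a.castSucc, a.succ} : Finset _) := by rw [ha]; simp
      have hj : j ∈ ({a.castSucc, a.succ} : Finset _) := by rw [ha]; simp
      have ha1 : a.castSucc ∈ ({i, j} : Finset _) := by rw [← ha]; simp
      have ha2 : a.succ ∈ ({i, j} : Finset _) := by rw [← ha]; simp
      simp only [Finset.mem_insert, Finset.mem_singleton, Fin.ext_iff, Fin.val_castSucc,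
        Fin.val_succ] at hi hj ha1 ha2
      omega
    · rintro (h | h)
      · refine ⟨⟨i, by omega⟩, ?_⟩
        congr 1
        exact congrArg _ (Fin.ext h)
      · refine ⟨⟨j, by omega⟩, ?_⟩
        rw [Finset.pair_comm i j]
        congr 1
        exact congrArg _ (Fin.ext h)
  have hEcard : E.card = L + 1 := by
    rw [Finset.card_image_of_injective, Finset.card_univ, Fintype.card_fin]
    intro a b hab
    have hb1 : b.castSucc ∈ ({a.castSucc, a.succ} : Finset _) := by
      simp only at hab; rw [hab]; simp
    have ha1 : a.castSucc ∈ ({b.castSucc, b.succ} : Finset _) := by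
      simp only at hab; rw [← hab]; simp
    simp only [Finset.mem_insert, Finset.mem_singleton, Fin.ext_iff, Fin.val_castSucc,
      Fin.val_succ] at hb1 ha1
    exact Fin.ext (by omega)
  have hE2 : ∀ s ∈ E, s.card = 2 := by
    intro s hs
    simp only [E, Finset.mem_image, Finset.mem_univ, true_and] at hs
    obtain ⟨a, rfl⟩ := hs
    exact Finset.card_pair (Fin.castSucc_lt_succ).ne
  -- `R` is required and `Z` forbidden: pairs encode the path, and `{0}` against `{Fin.last (L +
  -- 1)}` excludes its reversal.
  let R : Finset (Finset (Fin (L + 2))) := insert {0} E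
  let Z : Finset (Finset (Fin (L + 2))) :=
    insert {Fin.last (L + 1)} (Finset.powersetCard 2 Finset.univ \ E)
  have hR2 : ∀ s ∈ R, s.card ≤ 2 := by
    intro s hs
    rcases Finset.mem_insert.1 hs with rfl | hs
    · simp
    · exact (hE2 s hs).le
  have hZ2 : ∀ s ∈ Z, s.card ≤ 2 := by
    intro s hs
    rcases Finset.mem_insert.1 hs with rfl | hs
    · simp
    · exact (Finset.mem_powersetCard.1 (Finset.mem_sdiff.1 hs).1).2.le
  have hRZ : ∀ s ∈ R, s ∉ Z := by
    intro s hs hz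
    rcases Finset.mem_insert.1 hs with rfl | hs <;> rcases Finset.mem_insert.1 hz with hz | hz
    · have := congrArg Fin.val (Finset.singleton_injective hz)
      simp at this
    · have := (Finset.mem_powersetCard.1 (Finset.mem_sdiff.1 hz).1).2
      simp at this
    · have := hE2 s hs
      simp [hz] at this
    · exact (Finset.mem_sdiff.1 hz).2 hs
  have hRcard : (R.image norm).card ≤ L + 2 :=
    Finset.card_image_le.trans ((Finset.card_insert_le _ _).trans (by omega))
  have hZcard : (Z.image norm).card ≤ 2 ^ L := by
    refine Finset.card_image_le.trans ((Finset.card_insert_le _ _).trans ?_)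
    rw [Finset.card_sdiff_of_subset fun s hs =>
      Finset.mem_powersetCard.2 ⟨Finset.subset_univ _, hE2 s hs⟩, Finset.card_powersetCard,
      Finset.card_univ, Fintype.card_fin, hEcard]
    have h3 : (L + 2).choose 2 = (L + 1).choose 1 + (L + 1).choose 2 := Nat.choose_succ_succ _ _
    rw [Nat.choose_one_right] at h3
    have h4 := choose_two_lt_two_pow hL
    omega
  have hsub : R.image norm ⊆ T \ Z.image norm := by
    intro s hs
    obtain ⟨r, hr, rfl⟩ := Finset.mem_image.1 hs
    refine Finset.mem_sdiff.2 ⟨hnormT r, fun hz => ?_⟩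
    obtain ⟨z, hz, hzr⟩ := Finset.mem_image.1 hz
    exact hRZ r hr (hnorm_inj z r (hZ2 z hz) (hR2 r hr) hzr ▸ hz)
  -- At most half of the `2 ^ (L + 1)` bipartitions are forbidden.
  have hTZ : n ≤ (T \ Z.image norm).card := by
    have := Finset.le_card_sdiff (Z.image norm) T
    rw [hT, pow_succ] at this
    omega
  obtain ⟨A, hRA, hAT, hA⟩ := Finset.exists_subsuperset_card_eq hsub (hRcard.trans h1) hTZ
  have hA0 : ∀ s ∈ A, 0 ∉ s := fun s hs => (hmemT s).1 (Finset.mem_sdiff.1 (hAT hs)).1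
  have hP : ∀ s, (s ∈ A ∨ sᶜ ∈ A) ↔ norm s ∈ A := by
    intro s
    by_cases hs : 0 ∈ s
    · have : s ∉ A := fun h => hA0 s h hs
      simp [norm, hs, this]
    · have : sᶜ ∉ A := fun h => hA0 _ h (by simpa using hs)
      simp [norm, hs, this]
  have hPR : ∀ s ∈ R, norm s ∈ A := fun s hs => hRA (Finset.mem_image_of_mem _ hs)
  have hPZ : ∀ s ∈ Z, norm s ∉ A := fun s hs h =>
    (Finset.mem_sdiff.1 (hAT h)).2 (Finset.mem_image_of_mem _ hs)
  have hPE : ∀ i j : Fin (L + 2), i ≠ j → (norm {i, j} ∈ A ↔ {i, j} ∈ E) := by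
    intro i j hij
    refine ⟨fun h => ?_, fun h => hPR _ (Finset.mem_insert_of_mem h)⟩
    by_contra hc
    refine hPZ {i, j} (Finset.mem_insert_of_mem (Finset.mem_sdiff.2 ⟨?_, hc⟩)) h
    exact Finset.mem_powersetCard.2 ⟨Finset.subset_univ _, Finset.card_pair hij⟩
  refine ⟨A, hA, hA0, fun σ hσ => perm_eq_one_of_path σ (fun i j => ?_) fun h0 => ?_⟩
  · by_cases hij : i = j
    · subst hij; simp
    · have := hσ {i, j}
      rw [hP, hP, Finset.image_insert, Finset.image_singleton, hPE _ _ (σ.injective.ne hij),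
        hPE _ _ hij, hE, hE] at this
      exact this
  · have := hσ {0}
    rw [hP, hP, Finset.image_singleton, h0] at this
    exact hPZ _ (Finset.mem_insert_self _ _) (this.2 (hPR _ (Finset.mem_insert_self _ _)))

/-! ### Upper bound: a distinguishing class from the family. -/

lemma compl_image_perm {α : Type*} [Fintype α] [DecidableEq α] (σ : Equiv.Perm α)
    (s : Finset α) : (s.image σ)ᶜ = sᶜ.image σ := by
  ext a
  obtain ⟨b, rfl⟩ := σ.surjective a
  simp

lemma exists_isDistinguishingClass_ncard {L n : ℕ} (hL : 3 ≤ L) (h1 : L + 2 ≤ n)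
    (h2 : n ≤ 2 ^ L) :
    ∃ S, IsDistinguishingClass (hypercube n) S ∧ S.ncard = L + 2 := by
  obtain ⟨A, hA, hA0, hσ⟩ := exists_asymmetric_family hL h1 h2
  let e : Fin n ≃ A := (A.equivFinOfCardEq hA).symm
  let x : Fin (L + 2) → Fin n → ZMod 2 := fun r i => if r ∈ (e i).1 then 1 else 0
  have hx : ∀ r i, x r i = 1 ↔ r ∈ (e i).1 := by
    intro r i
    by_cases h : r ∈ (e i).1 <;> simp [x, h]
  have hxinj : Function.Injective x := by
    intro r r' hrr
    -- Swapping two equal rows would preserve every column, against asymmetry.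
    have hfix : ∀ s ∈ A, s.image (Equiv.swap r r') = s := by
      intro s hs
      have hs' : r ∈ s ↔ r' ∈ s := by
        have := hx r (e.symm ⟨s, hs⟩)
        rw [hrr, hx] at this
        simpa using this.symm
      ext a
      rw [← Equiv.coe_toEmbedding, ← Finset.map_eq_image, Finset.mem_map_equiv, Equiv.symm_swap]
      by_cases ha : a = r
      · subst ha; simp [hs']
      · by_cases ha' : a = r'
        · subst ha'; simp [hs']
        · rw [Equiv.swap_apply_of_ne_of_ne ha ha']
    have himg : ∀ s : Finset (Fin (L + 2)),
        (s.image (Equiv.swap r r')).image (Equiv.swap r r') = s := by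
      intro s
      ext a
      simp [Finset.image_image]
    have hmem : ∀ s, s.image (Equiv.swap r r') ∈ A ↔ s ∈ A := by
      intro s
      refine ⟨fun h => ?_, fun h => by rwa [hfix s h]⟩
      have h' := hfix _ h
      rw [himg] at h'
      rwa [h']
    have := hσ (Equiv.swap r r') fun s => by rw [compl_image_perm, hmem, hmem]
    rwa [Equiv.swap_eq_one_iff] at this
  refine ⟨Set.range x, (isDistinguishingClass_iff _ _).2 fun φ hφ => ?_, ?_⟩
  swap
  · rw [← Set.image_univ, Set.ncard_image_of_injective _ hxinj, Set.ncard_univ, Nat.card_fin]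
  obtain ⟨π, t, hπ⟩ := exists_perm_translation φ
  choose σ hxσ using fun r => (hφ (x r)).2 ⟨r, rfl⟩
  have hσinj : Function.Injective σ := by
    intro r r' h
    apply hxinj
    apply φ.injective
    rw [← hxσ, ← hxσ, h]
  let τ : Equiv.Perm (Fin (L + 2)) := Equiv.ofBijective σ (Finite.injective_iff_bijective.1 hσinj)
  have hcol : ∀ r i, x (σ r) (π i) = x r i + t (π i) := fun r i => by rw [hxσ, hπ]
  have himage : ∀ i, ((e i).1.image τ = (e (π i)).1) ∨ ((e i).1.image τ = ((e (π i)).1)ᶜ) := by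
    intro i
    rcases ZMod.two_eq_zero_or_one (t (π i)) with ht | ht
    · left
      ext a
      obtain ⟨r, rfl⟩ := τ.surjective a
      rw [τ.injective.mem_finset_image, ← hx, ← hx]
      change _ ↔ x (σ r) (π i) = 1
      rw [hcol, ht, add_zero]
    · right
      ext a
      obtain ⟨r, rfl⟩ := τ.surjective a
      rw [τ.injective.mem_finset_image, Finset.mem_compl, ← hx, ← hx]
      change _ ↔ ¬ x (σ r) (π i) = 1
      rw [hcol, ht]
      rcases ZMod.two_eq_zero_or_one (x r i) with h | h <;> simp [h]
  have hmap : ∀ s ∈ A, s.image τ ∈ A ∨ (s.image τ)ᶜ ∈ A := by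
    intro s hs
    obtain ⟨i, hi⟩ := e.surjective ⟨s, hs⟩
    have hi' : (e i).1 = s := by rw [hi]
    rcases himage i with h | h <;> rw [hi'] at h <;> rw [h]
    · exact Or.inl (e (π i)).2
    · exact Or.inr (by rw [compl_compl]; exact (e (π i)).2)
  have hcomap : ∀ s, s.image τ ∈ A → s ∈ A ∨ sᶜ ∈ A := by
    intro s hs
    obtain ⟨j, hj⟩ := e.surjective ⟨_, hs⟩
    obtain ⟨i, rfl⟩ := π.surjective j
    have hj' : (e (π i)).1 = s.image τ := by rw [hj]
    rcases himage i with h | h <;> rw [hj'] at h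
    · exact Or.inl (Finset.image_injective τ.injective h ▸ (e i).2)
    · rw [compl_image_perm] at h
      exact Or.inr (Finset.image_injective τ.injective h ▸ (e i).2)
  have hτ : τ = 1 := hσ τ fun s => by
    constructor
    · rintro (h | h)
      · exact hcomap s h
      · rw [compl_image_perm] at h
        simpa [or_comm] using hcomap _ h
    · rintro (h | h)
      · exact hmap s h
      · have := hmap _ h
        rw [← compl_image_perm, compl_compl] at this
        exact this.symm
  have hσ1 : ∀ r, σ r = r := fun r => congrArg (fun f : Equiv.Perm _ => f r) hτ
  -- Row `0` vanishes and is fixed, which forces the translation to be zero.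
  have hx0 : ∀ i, x 0 i = 0 := fun i => by simp [x, hA0 _ (e i).2]
  have ht : ∀ i, t (π i) = 0 := by
    intro i
    have := hcol 0 i
    rwa [hσ1, hx0, hx0, zero_add, eq_comm] at this
  have hπ1 : ∀ i, π i = i := by
    intro i
    apply e.injective
    ext r
    rw [← hx, ← hx]
    have := hcol r i
    rw [hσ1, ht, add_zero] at this
    rw [this]
  ext v i
  have := hπ v i
  rw [ht, hπ1, add_zero] at this
  simp [this]

theorem mainTheorem3 (n : ℕ) (hn : 5 ≤ n) :
    (distinguishingCost (hypercube n) : ℤ) = 1 + ⌈Real.logb 2 (n : ℝ)⌉ ∨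
      (distinguishingCost (hypercube n) : ℤ) = 2 + ⌈Real.logb 2 (n : ℝ)⌉ := by
  have hceil : ⌈Real.logb 2 (n : ℝ)⌉ = (Nat.clog 2 n : ℤ) := by
    have := Real.ceil_logb_natCast (b := 2) (r := (n : ℝ)) (Nat.cast_nonneg n)
    rw [Int.clog_natCast] at this
    exact_mod_cast this
  rw [hceil]
  obtain ⟨L, hLdef⟩ : ∃ L, Nat.clog 2 n = L := ⟨_, rfl⟩
  have h2 : n ≤ 2 ^ L := hLdef ▸ Nat.le_pow_clog one_lt_two n
  have hL : 3 ≤ L := by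
    by_contra! hlt
    have : 2 ^ L ≤ 2 ^ 2 := Nat.pow_le_pow_right two_pos (by omega)
    omega
  have hlt : 2 ^ (L - 1) < n := hLdef ▸ Nat.pow_pred_clog_lt_self one_lt_two (by omega)
  -- At `k = L - 1` this gives `L + 1 ≤ 2 ^ (L - 1) < n`.
  have hpow : ∀ k, 2 ≤ k → k + 2 ≤ 2 ^ k := by
    intro k hk
    induction k, hk using Nat.le_induction with
    | base => decide
    | succ k hk ih => rw [pow_succ]; omega
  have h1 : L + 2 ≤ n := by
    have := hpow (L - 1) (by omega)
    omega
  obtain ⟨S, hS, hcard⟩ := exists_isDistinguishingClass_ncard hL h1 h2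
  have hupper : distinguishingCost (hypercube n) ≤ L + 2 := Nat.sInf_le ⟨S, hS, hcard⟩
  have hlower : L + 1 ≤ distinguishingCost (hypercube n) := by
    -- The class `S` shows that the infimum is attained and is not the default `0`.
    obtain ⟨S', hS', hcard'⟩ : distinguishingCost (hypercube n) ∈
        {k : ℕ | ∃ S, IsDistinguishingClass (hypercube n) S ∧ S.ncard = k} :=
      Nat.sInf_mem ⟨_, S, hS, hcard⟩
    have h3 := le_two_pow_of_isDistinguishingClass hS'
    rw [hcard'] at h3
    have h4 := (Nat.clog_le_iff_le_pow one_lt_two).2 h3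
    omega
  rw [hLdef]
  omega
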